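/- Let $k$ be a field of characteristic $0$, and let $k((t^{\mathbb Q}))$ be the Mal'cev--Neumann field of formal sums $\sum_{i\in\mathbb Q} c_i t^i$ ($c_i\in k$) with well-ordered support $\{i : c_i\neq 0\}$, with termwise addition and convolution product. For $y=\sum c_it^i\neq 0$ let the valuation $v(y)$ be the smallest $i$ with $c_i\ne 0$; call $y$ monic if the coefficient of $t^{v(y)}$ is $1$. Give $k((t^{\mathbb Q}))$ the topology of the absolute value $|y|=e^{-v(y)}$ ($|0|=0$). Let $\operatorname{Aut}_{\rm conts}(k((t^{\mathbb Q}))/k)$ be the group of field automorphisms of $k((t^{\mathbb Q}))$ that restrict to the identity on $k$ and are continuous together with their inverse. Say that a family of elements of $k((t^{\mathbb Q}))$ has a formal sum if the union of the supports is well-ordered and each exponent lies in the support of only finitely many members; the formal sum is then obtained by adding the coefficients of equal exponents. Theorem. Let $x\in k((t^{\mathbb Q}))^*$ be monic of valuation $m>0$, and write $x=t^m(1+\epsilon)$. Then for every $i\in\mathbb Q$ the series $$x^i := t^{mi}\sum_{n=0}^\infty \binom{i}{n}\epsilon^n$$ converges in $k((t^{\mathbb Q}))$, both with respect to the absolute value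 and as a formal sum (with the same sum). There exists $\phi_x\in\operatorname{Aut}_{\rm conts}(k((t^{\mathbb Q}))/k)$ with $\phi_x(t)=x$ that is given by substitution: for every $y=\sum_i c_it^i\in k((t^{\mathbb Q}))$, the family $(c_i x^i)_{i\in\mathbb Q}$ and the double family $\bigl(c_i\binom{i}{n}t^{mi}\epsilon^n\bigr)_{(i,n)\in\mathbb Q\times\mathbb Z_{\ge 0}}$ both have formal sums, and both sums are equal to $\phi_x(y)$. -/

import Mathlib

noncomputable section

namespace MalcevNeumann

open HahnSeries

open Classical in
/-- The absolute value `|x| = e ^ (-v(x))` (with `|0| = 0`) on the Mal'cev-Neumann field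
`k((t^ℚ))`, which is Mathlib's `HahnSeries ℚ k`; for `x ≠ 0` the valuation `v(x)` is `x.order`. -/
def absVal (k : Type*) [Field k] : AbsoluteValue (HahnSeries ℚ k) ℝ where
  toFun x := if x = 0 then 0 else Real.exp (-(x.order : ℝ))
  map_mul' x y := by
    by_cases hx : x = 0
    · simp [hx]
    by_cases hy : y = 0
    · simp [hy]
    simp only [mul_eq_zero, hx, hy, or_self, if_false, order_mul hx hy, ← Real.exp_add]
    congr 1
    push_cast
    ring
  nonneg' x := by
    split_ifs
    · exact le_rfl
    · exact (Real.exp_pos _).le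
  eq_zero' x := by
    by_cases hx : x = 0 <;> simp [hx, Real.exp_ne_zero]
  add_le' x y := by
    by_cases hx : x = 0
    · simp [hx]
    by_cases hy : y = 0
    · simp [hy]
    by_cases hxy : x + y = 0
    · simp only [hx, hy, hxy, if_true, if_false]
      positivity
    simp only [hx, hy, hxy, if_false]
    have h : min x.order y.order ≤ (x + y).order := min_order_le_order_add hxy
    have hx0 := Real.exp_pos (-(x.order : ℝ))
    have hy0 := Real.exp_pos (-(y.order : ℝ))
    rcases min_le_iff.1 h with h | h
    · have : (x.order : ℝ) ≤ ((x + y).order : ℝ) := by exact_mod_cast h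
      linarith [Real.exp_le_exp.2 (neg_le_neg this)]
    · have : (y.order : ℝ) ≤ ((x + y).order : ℝ) := by exact_mod_cast h
      linarith [Real.exp_le_exp.2 (neg_le_neg this)]

/-- The topology on `k((t^ℚ))` defined by the absolute value. -/
@[reducible]
def topology (k : Type*) [Field k] : TopologicalSpace (HahnSeries ℚ k) :=
  (absVal k).toNormedField.toMetricSpace.toUniformSpace.toTopologicalSpace

/-- The group of continuous automorphisms of the field `k((t^ℚ))` whose restriction to the
subfield `k` (embedded by `c ↦ c * t ^ 0`) is the identity; being a group of homeomorphisms, it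
consists of the automorphisms that are continuous together with their inverse. -/
def autConts (k : Type*) [Field k] : Subgroup (RingAut (HahnSeries ℚ k)) where
  carrier := {φ | (∀ c : k, φ (C c) = C c) ∧
    @Continuous _ _ (topology k) (topology k) φ ∧
    @Continuous _ _ (topology k) (topology k) φ.symm}
  one_mem' := by
    let := topology k
    exact ⟨fun _ => rfl, continuous_id, continuous_id⟩
  mul_mem' := by
    let := topology k
    rintro a b ⟨h, ha, ha'⟩ ⟨h', hb, hb'⟩
    exact ⟨fun c => (congrArg a (h' c)).trans (h c), ha.comp hb, hb'.comp ha'⟩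
  inv_mem' := by
    rintro a ⟨h, ha, ha'⟩
    exact ⟨fun c => a.symm_apply_eq.2 (h c).symm, ha', ha⟩

variable {k : Type*} [Field k]

/-- The family `f` of generalized power series can be summed formally, with sum `y`: the union of
the supports is well-ordered, each exponent occurs in only finitely many members, and `y` is
obtained by collecting the terms with the same exponent. -/
def HasFormalSum {α : Type*} (f : α → HahnSeries ℚ k) (y : HahnSeries ℚ k) : Prop :=
  ∃ s : SummableFamily ℚ k α, ⇑s = f ∧ s.hsum = y

/-- The series `ε` with `x = t ^ m * (1 + ε)`, where `m` is the valuation of the monic series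
`x`. -/
def eps (x : HahnSeries ℚ k) : HahnSeries ℚ k :=
  single (-x.order) 1 * x - 1

/-- The `n`-th term `binom(i, n) * t ^ (m * i) * ε ^ n` of the binomial expansion of
`x ^ i = t ^ (m * i) * (1 + ε) ^ i`. -/
def powTerm [CharZero k] (x : HahnSeries ℚ k) (i : ℚ) (n : ℕ) : HahnSeries ℚ k :=
  single (x.order * i) ((Ring.choose i n : ℚ) : k) * eps x ^ n

/-- The power `x ^ i = t ^ (m * i) * ∑ n, binom(i, n) * ε ^ n` with rational exponent `i`, for
`x` monic of valuation `m`. -/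
def ratPow [CharZero k] (x : HahnSeries ℚ k) (i : ℚ) : HahnSeries ℚ k :=
  single (x.order * i) 1 * (SummableFamily.binomialFamily (1 + eps x) i).hsum

end MalcevNeumann

end

/-! Let `S` be the additive monoid generated by the support of `ε`. That support is positive and
well-ordered, so `S` is well-ordered, and `x ^ i` has the form `t ^ (m * i)` plus terms with
exponents in `m * i + S`. Products of summable families are summable, so the double family has a
formal sum `φ(y)`; Fubini groups it into `∑ c_i x ^ i`. Multiplicativity follows from `x ^ (i + j) =
x ^ i * x ^ j` by reindexing (`subst_mul`). Since `m > 0`, leading terms cannot cancel: `φ`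
multiplies valuations by `m` (`order_subst`), so `|φ(y)| = |y| ^ m`. This gives injectivity and
continuity in both directions. Surjectivity is a unitriangular linear system in the coefficients,
solved by recursion along a well-ordered set of exponents (`subst_surjective`). -/

noncomputable section

/-! ### Fubini for formal sums. -/

namespace HahnSeries.SummableFamily

variable {Γ R α β : Type*} [PartialOrder Γ] [AddCommMonoid R]

/-- The members of a doubly indexed summable family with a fixed first index. -/
def row (s : SummableFamily Γ R (α × β)) (a : α) : SummableFamily Γ R β where
  toFun b := s (a, b)
  isPWO_iUnion_support' := s.isPWO_iUnion_support.mono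
    (Set.iUnion_subset fun b => Set.subset_iUnion (fun p => (s p).support) (a, b))
  finite_co_support' g :=
    Set.Finite.preimage (f := fun b => (a, b)) (Prod.mk_right_injective a).injOn
      (s.finite_co_support g)

@[simp]
theorem row_apply (s : SummableFamily Γ R (α × β)) (a : α) (b : β) : s.row a b = s (a, b) := rfl

/-- The summable family of the sums over the second index. -/
def rowSum (s : SummableFamily Γ R (α × β)) : SummableFamily Γ R α where
  toFun a := (s.row a).hsum
  isPWO_iUnion_support' := s.isPWO_iUnion_support.mono <| Set.iUnion_subset fun a =>
    (s.row a).support_hsum_subset.trans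
      (Set.iUnion_subset fun b => Set.subset_iUnion (fun p => (s p).support) (a, b))
  finite_co_support' g := ((s.finite_co_support g).image Prod.fst).subset fun a ha => by
    have ha : g ∈ (s.row a).hsum.support := ha
    obtain ⟨b, hb⟩ := Set.mem_iUnion.1 ((s.row a).support_hsum_subset ha)
    exact ⟨(a, b), hb, rfl⟩

@[simp]
theorem rowSum_apply (s : SummableFamily Γ R (α × β)) (a : α) : s.rowSum a = (s.row a).hsum := rfl

/-- At each exponent only finitely many terms are nonzero, so this is Fubini for finite sums. -/
theorem hsum_rowSum (s : SummableFamily Γ R (α × β)) : s.rowSum.hsum = s.hsum := by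
  ext g
  simp only [coeff_hsum, rowSum_apply, row_apply]
  exact (finsum_curry _ (s.finite_co_support g)).symm

end HahnSeries.SummableFamily

/-! ### The double family of the substitution. -/

namespace MalcevNeumann

open HahnSeries
open scoped Pointwise

variable {k : Type*} [Field k]

/-- Summing over all second exponents `j`, not over a set depending on `l`, matches the rows of the
reindexed product family in `subst_mul`. -/
theorem coeff_mul_eq_finsum (y z : HahnSeries ℚ k) (l : ℚ) :
    (y * z).coeff l = ∑ᶠ j, y.coeff (l - j) * z.coeff j := by
  classical
  rw [coeff_mul, finsum_eq_sum_of_support_subset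
    (s := (Finset.antidiagonal y.isPWO_support z.isPWO_support l).image Prod.snd)]
  · rw [Finset.sum_image]
    · refine Finset.sum_congr rfl fun p hp => ?_
      rw [← (Finset.mem_antidiagonal.1 hp).2.2, add_sub_cancel_right]
    · intro p hp q hq h
      have hp := (Finset.mem_antidiagonal.1 hp).2.2
      have hq := (Finset.mem_antidiagonal.1 hq).2.2
      exact Prod.ext (by linarith) h
  · intro j hj
    simp only [Finset.coe_image, Set.mem_image, Finset.mem_coe, Finset.mem_antidiagonal]
    exact ⟨(l - j, j), ⟨left_ne_zero_of_mul hj, right_ne_zero_of_mul hj, sub_add_cancel _ _⟩, rfl⟩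

theorem eps_orderTop_pos {x : HahnSeries ℚ k} (hx : x.leadingCoeff = 1) :
    0 < (eps x).orderTop := by
  have h := unit_aux x (r := 1) (by simp [hx]) (-x.order) (neg_add_cancel _)
  rwa [← orderTop_neg, neg_sub] at h

theorem single_mul_one_add_eps (x : HahnSeries ℚ k) :
    single x.order 1 * (1 + eps x) = x := by
  rw [eps, add_sub_cancel, ← mul_assoc, single_mul_single]
  simp

/-- The family of monomials `c_i * t ^ (m * i)` for `y = ∑ c_i t ^ i`. -/
def monomialFamily (m : ℚ) (hm : 0 < m) (y : HahnSeries ℚ k) : SummableFamily ℚ k ℚ where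
  toFun i := single (m * i) (y.coeff i)
  isPWO_iUnion_support' := by
    have h := y.isPWO_support.image_of_monotone (f := fun i => m * i)
      (fun a b h => mul_le_mul_of_nonneg_left h hm.le)
    refine h.mono (Set.iUnion_subset fun i g hg => ?_)
    have hgi : g = m * i := by
      by_contra hne
      exact hg (coeff_single_of_ne hne)
    subst hgi
    exact ⟨i, by simpa using hg, rfl⟩
  finite_co_support' g := by
    refine (Set.finite_singleton (g / m)).subset fun i hi => ?_
    have hgi : g = m * i := by
      by_contra hne
      exact hi (coeff_single_of_ne hne)
    rw [Set.mem_singleton_iff, hgi, mul_div_cancel_left₀ _ hm.ne']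

variable [CharZero k]

/-- The double family `c_i * binom(i, n) * t ^ (m * i) * ε ^ n`. -/
def substFamily (x : HahnSeries ℚ k) (hm : 0 < x.order) (y : HahnSeries ℚ k) :
    SummableFamily ℚ k (ℚ × ℕ) :=
  -- Scaling by binomial coefficients only shrinks supports, so summability comes from the product
  -- of the two families.
  SummableFamily.smulFamily (fun p => ((Ring.choose p.1 p.2 : ℚ) : k))
    ((monomialFamily x.order hm y).mul (SummableFamily.powers (eps x)))

theorem powTerm_eq_C_mul (x : HahnSeries ℚ k) (i : ℚ) (n : ℕ) :
    powTerm x i n = C ((Ring.choose i n : ℚ) : k) * (single (x.order * i) 1 * eps x ^ n) := by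
  rw [powTerm, ← mul_assoc, C_apply, single_mul_single, zero_add, mul_one]

/-! ### Rational powers of a monic series. -/

section Monic

variable {x : HahnSeries ℚ k}

/-- Evaluating power series at `ε` is multiplicative, so the identity for binomial series with
exponents `i`, `j` and `i + j` carries over. -/
theorem ratPow_add (i j : ℚ) : ratPow x (i + j) = ratPow x i * ratPow x j := by
  have h : (SummableFamily.binomialFamily (1 + eps x) (i + j)).hsum =
      (SummableFamily.binomialFamily (1 + eps x) i).hsum *
        (SummableFamily.binomialFamily (1 + eps x) j).hsum := by
    simp [SummableFamily.binomialFamily, SummableFamily.hsum_powerSeriesFamily_mul,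
      SummableFamily.hsum_mul]
  rw [ratPow, ratPow, ratPow, h, mul_mul_mul_comm, single_mul_single, mul_one, mul_add]

variable (hx : x.leadingCoeff = 1)
include hx

theorem binomialFamily_eps_apply (i : ℚ) (n : ℕ) :
    SummableFamily.binomialFamily (1 + eps x) i n =
      C ((Ring.choose i n : ℚ) : k) * eps x ^ n := by
  rw [SummableFamily.binomialFamily_apply (by simpa using eps_orderTop_pos hx),
    add_sub_cancel_left, C_mul_eq_smul]
  ext g
  rw [coeff_smul, coeff_smul, Rat.smul_def, smul_eq_mul]

theorem coe_single_smul_binomialFamily (i : ℚ) :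
    ⇑((single (x.order * i) (1 : k)) • SummableFamily.binomialFamily (1 + eps x) i) =
      powTerm x i := by
  ext1 n
  rw [SummableFamily.smul_apply, of_symm_smul_of_eq_mul, binomialFamily_eps_apply hx,
    powTerm_eq_C_mul, mul_left_comm]

theorem hasFormalSum_powTerm (i : ℚ) : HasFormalSum (powTerm x i) (ratPow x i) :=
  ⟨_, coe_single_smul_binomialFamily hx i, SummableFamily.hsum_smul⟩

theorem substFamily_apply (hm : 0 < x.order) (y : HahnSeries ℚ k) (p : ℚ × ℕ) :
    substFamily x hm y p = C (y.coeff p.1) * powTerm x p.1 p.2 := by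
  change ((Ring.choose p.1 p.2 : ℚ) : k) • (single _ _ * SummableFamily.powers (eps x) p.2) = _
  rw [SummableFamily.powers_of_orderTop_pos (eps_orderTop_pos hx), powTerm_eq_C_mul,
    mul_left_comm, ← C_mul_eq_smul]
  congr 1
  rw [← mul_assoc, C_apply, single_mul_single, zero_add, mul_one]

theorem rowSum_substFamily_apply (hm : 0 < x.order) (y : HahnSeries ℚ k) (i : ℚ) :
    (substFamily x hm y).rowSum i = C (y.coeff i) * ratPow x i := by
  rw [SummableFamily.rowSum_apply, ratPow, ← SummableFamily.hsum_smul, ← SummableFamily.hsum_smul]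
  congr 1
  ext1 n
  rw [SummableFamily.row_apply, substFamily_apply hx, SummableFamily.smul_apply,
    of_symm_smul_of_eq_mul, coe_single_smul_binomialFamily hx]

theorem ratPow_natCast (d : ℕ) : ratPow x d = x ^ d := by
  have h : (SummableFamily.binomialFamily (1 + eps x) (d : ℚ)).hsum = (1 + eps x) ^ d := by
    change PowerSeries.heval (1 + eps x - 1) (PowerSeries.binomialSeries k (d : ℚ)) = _
    rw [PowerSeries.binomialSeries_nat, map_pow, map_add, map_one, add_sub_cancel_left,
      PowerSeries.heval_X _ (eps_orderTop_pos hx)]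
  conv_rhs => rw [← single_mul_one_add_eps x, mul_pow, single_pow, one_pow]
  rw [ratPow, h, nsmul_eq_mul, mul_comm x.order]

theorem ratPow_zero : ratPow x 0 = 1 := by
  simpa using ratPow_natCast hx 0

theorem ratPow_one : ratPow x 1 = x := by
  simpa using ratPow_natCast hx 1

/-- Every `ε ^ n` is supported in the monoid generated by the support of `ε`. This one bound,
uniform in `i`, yields both the leading term of `x ^ i` and the well-ordered index set for
surjectivity. -/
theorem coeff_ratPow_mem {i g : ℚ} (h : (ratPow x i).coeff g ≠ 0) :
    g - x.order * i ∈ AddSubmonoid.closure (eps x).support := by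
  rw [ratPow, coeff_single_mul, one_mul] at h
  obtain ⟨n, hn⟩ := Set.mem_iUnion.1 (SummableFamily.support_hsum_subset h)
  rw [binomialFamily_eps_apply hx, C_mul_eq_smul, mem_support, coeff_smul] at hn
  exact SummableFamily.support_pow_subset_closure _ n (right_ne_zero_of_smul hn)

omit [CharZero k] in
theorem eps_support_pos {g : ℚ} (hg : g ∈ (eps x).support) : 0 < g :=
  WithTop.coe_pos.1 ((eps_orderTop_pos hx).trans_le (orderTop_le_of_coeff_ne_zero hg))

omit [CharZero k] in
theorem nonneg_of_mem_closure {g : ℚ} (hg : g ∈ AddSubmonoid.closure (eps x).support) :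
    0 ≤ g :=
  (AddSubmonoid.closure_le (S := AddSubmonoid.nonneg ℚ)).2
    (fun _ h => (eps_support_pos hx h).le) hg

omit [CharZero k] in
theorem isPWO_closure : (AddSubmonoid.closure (eps x).support : Set ℚ).IsPWO :=
  (eps x).isPWO_support.addSubmonoid_closure fun _ h => (eps_support_pos hx h).le

theorem order_mul_le_of_coeff_ratPow_ne_zero {i g : ℚ} (h : (ratPow x i).coeff g ≠ 0) :
    x.order * i ≤ g :=
  sub_nonneg.1 (nonneg_of_mem_closure hx (coeff_ratPow_mem hx h))

/-- The terms with `n > 0` have positive order, so only `n = 0` contributes at the leading exponent.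
-/
theorem coeff_ratPow_self (i : ℚ) : (ratPow x i).coeff (x.order * i) = 1 := by
  rw [ratPow, coeff_single_mul, one_mul, sub_self, SummableFamily.coeff_hsum,
    finsum_eq_single _ 0]
  · rw [binomialFamily_eps_apply hx]
    simp
  · intro n hn
    exact coeff_eq_zero_of_lt_orderTop (SummableFamily.binomialFamily_orderTop_pos
      (by simpa using eps_orderTop_pos hx) i (Nat.pos_of_ne_zero hn))

/-! ### Convergence of the binomial series in absolute value -/

omit [CharZero k] in
theorem exists_pos_le_orderTop_eps : ∃ δ : ℚ, 0 < δ ∧ (δ : WithTop ℚ) ≤ (eps x).orderTop := by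
  -- If `ε = 0` its order is infinite and any positive `δ` will do.
  by_cases h : eps x = 0
  · exact ⟨1, one_pos, by simp [h]⟩
  · refine ⟨(eps x).order, (zero_lt_orderTop_iff h).1 (eps_orderTop_pos hx), ?_⟩
    rw [order_eq_orderTop_of_ne_zero h]

omit hx in
theorem coeff_powTerm_eq_zero {δ : ℚ} (hδ : (δ : WithTop ℚ) ≤ (eps x).orderTop) (i g : ℚ) (n : ℕ)
    (hg : g < x.order * i + n * δ) : (powTerm x i n).coeff g = 0 := by
  have h : (eps x ^ n).coeff (g - x.order * i) = 0 := by
    refine coeff_eq_zero_of_lt_orderTop (lt_of_lt_of_le ?_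
      ((nsmul_le_nsmul_right hδ n).trans orderTop_nsmul_le_orderTop_pow))
    rw [← WithTop.coe_nsmul, WithTop.coe_lt_coe, nsmul_eq_mul]
    linarith
  rw [powTerm, coeff_single_mul, h, mul_zero]

/-- The omitted terms `n ≥ N` have no coefficients below `m * i + N * δ`. -/
theorem coeff_sum_powTerm_sub {δ : ℚ} (hδ0 : 0 < δ) (hδ : (δ : WithTop ℚ) ≤ (eps x).orderTop)
    (i g : ℚ) (N : ℕ) (hg : g < x.order * i + N * δ) :
    ((∑ n ∈ Finset.range N, powTerm x i n) - ratPow x i).coeff g = 0 := by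
  obtain ⟨s, hs, hsum⟩ := hasFormalSum_powTerm hx i
  rw [coeff_sub, ← hsum, SummableFamily.coeff_hsum_eq_sum_of_subset (t := Finset.range N), hs,
    coeff_sum, sub_self]
  intro n hn
  rw [Finset.coe_range, Set.mem_Iio]
  by_contra! hNn
  refine hn ?_
  rw [hs]
  refine coeff_powTerm_eq_zero hδ i g n (hg.trans_le ?_)
  have : (N : ℚ) ≤ n := by exact_mod_cast hNn
  gcongr

omit hx [CharZero k] in
open Classical in
theorem absVal_apply (y : HahnSeries ℚ k) :
    absVal k y = if y = 0 then 0 else Real.exp (-(y.order : ℝ)) := rfl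

omit hx [CharZero k] in
theorem absVal_le_exp {y : HahnSeries ℚ k} {r : ℚ} (h : ∀ g < r, y.coeff g = 0) :
    absVal k y ≤ Real.exp (-(r : ℝ)) := by
  rw [absVal_apply]
  split_ifs with hy
  · exact (Real.exp_pos _).le
  · rw [Real.exp_le_exp, neg_le_neg_iff, Rat.cast_le]
    by_contra! hr
    exact coeff_order_eq_zero.not.2 hy (h _ hr)

theorem tendsto_absVal_sum_powTerm_sub (i : ℚ) :
    Filter.Tendsto
      (fun N : ℕ => absVal k ((∑ n ∈ Finset.range N, powTerm x i n) - ratPow x i))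
      Filter.atTop (nhds 0) := by
  obtain ⟨δ, hδ0, hδ⟩ := exists_pos_le_orderTop_eps hx
  refine squeeze_zero (fun N => (absVal k).nonneg _)
    (fun N => absVal_le_exp fun g hg => coeff_sum_powTerm_sub hx hδ0 hδ i g N hg) ?_
  refine Real.tendsto_exp_neg_atTop_nhds_zero.comp ?_
  push_cast
  refine Filter.tendsto_atTop_add_const_left _ _
    (tendsto_natCast_atTop_atTop.atTop_mul_const ?_)
  exact_mod_cast hδ0

/-! ### Substitution -/

variable (hm : 0 < x.order)

/-- Substitution of `x` for `t`. -/
def subst (x : HahnSeries ℚ k) (hm : 0 < x.order) (y : HahnSeries ℚ k) : HahnSeries ℚ k :=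
  (substFamily x hm y).hsum

theorem hasFormalSum_subst_powTerm (y : HahnSeries ℚ k) :
    HasFormalSum (fun p : ℚ × ℕ => C (y.coeff p.1) * powTerm x p.1 p.2) (subst x hm y) :=
  ⟨substFamily x hm y, funext fun p => substFamily_apply hx hm y p, rfl⟩

theorem hasFormalSum_subst_ratPow (y : HahnSeries ℚ k) :
    HasFormalSum (fun i : ℚ => C (y.coeff i) * ratPow x i) (subst x hm y) :=
  ⟨(substFamily x hm y).rowSum, funext fun i => rowSum_substFamily_apply hx hm y i,
    SummableFamily.hsum_rowSum _⟩

theorem coeff_subst (y : HahnSeries ℚ k) (g : ℚ) :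
    (subst x hm y).coeff g = ∑ᶠ i, y.coeff i * (ratPow x i).coeff g := by
  obtain ⟨s, hs, hsum⟩ := hasFormalSum_subst_ratPow hx hm y
  rw [← hsum, SummableFamily.coeff_hsum, hs]
  simp only [C_mul_eq_smul, coeff_smul, smul_eq_mul]

include hm in
theorem finite_support_coeff_mul_coeff_ratPow (y : HahnSeries ℚ k) (g : ℚ) :
    (fun i => y.coeff i * (ratPow x i).coeff g).HasFiniteSupport := by
  obtain ⟨s, hs, -⟩ := hasFormalSum_subst_ratPow hx hm y
  have h := s.finite_co_support g
  rw [hs] at h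
  simpa only [C_mul_eq_smul, coeff_smul, smul_eq_mul] using h

theorem subst_add (y z : HahnSeries ℚ k) :
    subst x hm (y + z) = subst x hm y + subst x hm z := by
  ext g
  rw [coeff_add, coeff_subst hx, coeff_subst hx, coeff_subst hx,
    ← finsum_add_distrib (finite_support_coeff_mul_coeff_ratPow hx hm y g)
      (finite_support_coeff_mul_coeff_ratPow hx hm z g)]
  simp only [coeff_add, add_mul]

theorem subst_single (i : ℚ) (c : k) : subst x hm (single i c) = C c * ratPow x i := by
  ext g
  rw [coeff_subst hx, finsum_eq_single _ i, coeff_single_same, C_mul_eq_smul, coeff_smul,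
    smul_eq_mul]
  intro j hj
  rw [coeff_single_of_ne hj, zero_mul]

theorem subst_C (c : k) : subst x hm (C c) = C c := by
  rw [C_apply, subst_single hx, ratPow_zero hx, mul_one, C_apply]

theorem subst_mul (y z : HahnSeries ℚ k) :
    subst x hm (y * z) = subst x hm y * subst x hm z := by
  obtain ⟨s, hs, hsum⟩ := hasFormalSum_subst_ratPow hx hm y
  obtain ⟨s', hs', hsum'⟩ := hasFormalSum_subst_ratPow hx hm z
  -- In the new indices `(l, j)` with `l = i + j`, row `l` collects the products `c_i d_j x ^ l`,
  -- whose scalars add up to the coefficient of `y * z` at `l`.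
  let e : ℚ × ℚ ≃ ℚ × ℚ :=
    { toFun := fun p => (p.1 + p.2, p.2)
      invFun := fun p => (p.1 - p.2, p.2)
      left_inv := fun p => by simp
      right_inv := fun p => by simp }
  rw [← hsum, ← hsum', ← SummableFamily.hsum_mul, ← SummableFamily.hsum_equiv e,
    ← SummableFamily.hsum_rowSum]
  ext g
  rw [coeff_subst hx, SummableFamily.coeff_hsum]
  refine finsum_congr fun l => ?_
  rw [coeff_mul_eq_finsum, finsum_mul, SummableFamily.rowSum_apply, SummableFamily.coeff_hsum]
  refine finsum_congr fun j => ?_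
  change _ = (s (l - j) * s' j).coeff g
  rw [hs, hs', mul_mul_mul_comm, ← ratPow_add, ← map_mul, sub_add_cancel, C_mul_eq_smul,
    coeff_smul, smul_eq_mul]

/-! ### Valuations, bijectivity and continuity. -/

theorem order_subst {y : HahnSeries ℚ k} (hy : y ≠ 0) :
    subst x hm y ≠ 0 ∧ (subst x hm y).order = x.order * y.order := by
  have h : (subst x hm y).orderTop = ((x.order * y.order : ℚ) : WithTop ℚ) := by
    refine orderTop_eq_of_le ?_ ?_
    · rw [mem_support, coeff_subst hx, finsum_eq_single _ y.order, coeff_ratPow_self hx, mul_one]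
      · exact coeff_order_eq_zero.not.2 hy
      -- A contributing `i` is at least `y.order`, as it lies in the support of `y`, and at most
      -- `y.order`, as `x ^ i` starts at `m * i`.
      · intro i hi
        by_contra hne
        have h1 := order_le_of_coeff_ne_zero (left_ne_zero_of_mul hne)
        have h2 := order_mul_le_of_coeff_ratPow_ne_zero hx (right_ne_zero_of_mul hne)
        exact hi (le_antisymm (le_of_mul_le_mul_left h2 hm) h1)
    · intro g hg
      rw [mem_support, coeff_subst hx] at hg
      obtain ⟨i, hi⟩ : ∃ i, y.coeff i * (ratPow x i).coeff g ≠ 0 := by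
        by_contra! h
        exact hg (finsum_eq_zero_of_forall_eq_zero h)
      have h1 := order_le_of_coeff_ne_zero (left_ne_zero_of_mul hi)
      have h2 := order_mul_le_of_coeff_ratPow_ne_zero hx (right_ne_zero_of_mul hi)
      exact (mul_le_mul_of_nonneg_left h1 hm.le).trans h2
  have h0 : subst x hm y ≠ 0 := by
    intro h0
    rw [h0, orderTop_zero] at h
    exact WithTop.top_ne_coe h
  refine ⟨h0, ?_⟩
  rwa [← order_eq_orderTop_of_ne_zero h0, WithTop.coe_eq_coe] at h

theorem absVal_subst (y : HahnSeries ℚ k) :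
    absVal k (subst x hm y) = absVal k y ^ (x.order : ℝ) := by
  have hm' : (x.order : ℝ) ≠ 0 := by exact_mod_cast hm.ne'
  by_cases hy : y = 0
  · rw [hy, ← map_zero C, subst_C hx, map_zero, map_zero, Real.zero_rpow hm']
  · obtain ⟨h0, h⟩ := order_subst hx hm hy
    rw [absVal_apply, absVal_apply, if_neg h0, if_neg hy, h, ← Real.exp_mul]
    push_cast
    congr 1
    ring

/-- The coefficient of `φ(y)` at `m * i` is `c_i` plus a combination of the `c_j` with `j < i`, so
the `c_i` can be solved for recursively once their indices are confined to a well-ordered set. -/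
theorem subst_surjective : Function.Surjective (subst x hm) := by
  intro z
  -- With `S` the monoid generated by the support of `ε`, `m * T = supp z + S`: it contains `supp z`
  -- and is stable under adding `S`, so no `x ^ j` with `j ∈ T` has exponents outside `m * T`.
  let T : Set ℚ := (fun g => x.order⁻¹ * g) ''
    (z.support + (AddSubmonoid.closure (eps x).support : Set ℚ))
  have hT : T.IsPWO := (z.isPWO_support.add (isPWO_closure hx)).image_of_monotone
    fun a b h => mul_le_mul_of_nonneg_left h (inv_nonneg.2 hm.le)
  have hmem : ∀ i, i ∈ T ↔ x.order * i ∈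
      z.support + (AddSubmonoid.closure (eps x).support : Set ℚ) := by
    intro i
    constructor
    · rintro ⟨g, hg, rfl⟩
      simpa only [mul_inv_cancel_left₀ hm.ne'] using hg
    · intro h
      exact ⟨_, h, inv_mul_cancel_left₀ hm.ne' _⟩
  have wf : WellFounded (fun i j : T => i < j) := hT.isWF
  classical
  -- The equation at `m * i` solved for `c_i`; the sum runs over all rationals, with value `0` off
  -- the predecessors of `i` in `T`, to match `coeff_subst` termwise.
  let F : ∀ i : T, (∀ j : T, j < i → k) → k := fun i ih =>
    z.coeff (x.order * i) - ∑ᶠ j : ℚ,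
      if h : ∃ hj : j ∈ T, (⟨j, hj⟩ : T) < i then
        ih ⟨j, h.1⟩ h.2 * (ratPow x j).coeff (x.order * i) else 0
  let W : T → k := wf.fix F
  have hW : ∀ i, W i = F i fun j _ => W j := wf.fix_eq F
  let y : HahnSeries ℚ k :=
    { coeff := fun i => if h : i ∈ T then W ⟨i, h⟩ else 0
      isPWO_support' := hT.mono fun i hi => by
        by_contra h
        exact hi (dif_neg h) }
  have hyT : ∀ i (h : i ∈ T), y.coeff i = W ⟨i, h⟩ := fun i h => dif_pos h
  have hy0 : ∀ i, i ∉ T → y.coeff i = 0 := fun i h => dif_neg h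
  refine ⟨y, ?_⟩
  ext g
  obtain ⟨i, rfl⟩ : ∃ i, g = x.order * i := ⟨_, (mul_inv_cancel_left₀ hm.ne' g).symm⟩
  rw [coeff_subst hx]
  by_cases hi : i ∈ T
  -- The diagonal term `j = i` has coefficient `1`; it is split off and replaced by its recursive
  -- value.
  · rw [← add_finsum_cond_ne i (finite_support_coeff_mul_coeff_ratPow hx hm y _),
      coeff_ratPow_self hx, mul_one, hyT i hi, hW, sub_add_eq_add_sub, sub_eq_iff_eq_add]
    congr 1
    refine finsum_congr fun j => ?_
    by_cases hj : ∃ hj : j ∈ T, (⟨j, hj⟩ : T) < ⟨i, hi⟩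
    · have hne : j ≠ i := fun h => (lt_irrefl i) (h ▸ hj.2)
      rw [dif_pos hj, finsum_eq_if, if_pos hne, hyT j hj.1]
    · rw [dif_neg hj, finsum_eq_if]
      refine ite_eq_right_iff.2 fun hne => ?_
      by_contra h0
      have hjT : j ∈ T := by
        by_contra h
        exact left_ne_zero_of_mul h0 (hy0 j h)
      have hji := order_mul_le_of_coeff_ratPow_ne_zero hx (right_ne_zero_of_mul h0)
      exact hj ⟨hjT, Subtype.mk_lt_mk.2 (lt_of_le_of_ne (le_of_mul_le_mul_left hji hm) hne)⟩
  · have hz : z.coeff (x.order * i) = 0 := by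
      by_contra h
      exact hi ((hmem i).2 ⟨_, h, 0, zero_mem _, add_zero _⟩)
    rw [hz]
    refine finsum_eq_zero_of_forall_eq_zero fun j => ?_
    by_contra h0
    have hjT : j ∈ T := by
      by_contra h
      exact left_ne_zero_of_mul h0 (hy0 j h)
    obtain ⟨a, ha, b, hb, hab⟩ := (hmem j).1 hjT
    -- Here `m * j = a + b` and `m * i - m * j ∈ S`, so a nonzero term would put `i` in `T`.
    refine hi ((hmem i).2 ⟨a, ha, _,
      add_mem hb (coeff_ratPow_mem hx (right_ne_zero_of_mul h0)), ?_⟩)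
    have hab : a + b = x.order * j := hab
    change a + (b + _) = _
    linarith

/-- Substitution of `x` for `t`, as a field automorphism. -/
def substEquiv : RingAut (HahnSeries ℚ k) :=
  RingEquiv.ofBijective
    (RingHom.mk' { toFun := subst x hm
                   map_one' := by rw [← map_one C, subst_C hx]
                   map_mul' := subst_mul hx hm } (subst_add hx hm))
    ⟨(injective_iff_map_eq_zero _).2 fun y hy => by
      by_contra h
      exact (order_subst hx hm h).1 hy, subst_surjective hx hm⟩

theorem substEquiv_apply (y : HahnSeries ℚ k) : substEquiv hx hm y = subst x hm y := rfl

omit hx [CharZero k] in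
-- Additivity turns the power law into `|φ a - φ b| = |a - b| ^ r`. It serves `φ` with `r = m` and
-- its inverse with `r = 1 / m`.
theorem continuous_of_absVal_map_eq_rpow (φ : RingAut (HahnSeries ℚ k)) {r : ℝ} (hr : 0 < r)
    (h : ∀ y, absVal k (φ y) = absVal k y ^ r) :
    @Continuous _ _ (topology k) (topology k) φ := by
  let := (absVal k).toNormedField
  refine Metric.continuous_iff.2 fun b ε hε => ⟨ε ^ r⁻¹, Real.rpow_pos_of_pos hε _, fun a ha => ?_⟩
  have ha : absVal k (a - b) < ε ^ r⁻¹ := (dist_eq_norm a b).symm.trans_lt ha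
  have : absVal k (φ a - φ b) < ε := by
    rw [← map_sub, h]
    refine (Real.rpow_lt_rpow ((absVal k).nonneg _) ha hr).trans_eq ?_
    rw [← Real.rpow_mul hε.le, inv_mul_cancel₀ hr.ne', Real.rpow_one]
  exact (dist_eq_norm (φ a) (φ b)).trans_lt this

theorem substEquiv_mem_autConts : substEquiv hx hm ∈ autConts k := by
  have hm' : (0 : ℝ) < x.order := by exact_mod_cast hm
  refine ⟨subst_C hx hm, continuous_of_absVal_map_eq_rpow _ hm' (absVal_subst hx hm),
    continuous_of_absVal_map_eq_rpow _ (inv_pos.2 hm') fun y => ?_⟩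
  obtain ⟨z, rfl⟩ := (substEquiv hx hm).surjective y
  rw [RingEquiv.symm_apply_apply, substEquiv_apply, absVal_subst hx,
    ← Real.rpow_mul ((absVal k).nonneg _), mul_inv_cancel₀ hm'.ne', Real.rpow_one]

end Monic

end MalcevNeumann
end

theorem mainTheorem10 {k : Type*} [Field k] [CharZero k] (x : HahnSeries ℚ k)
    (hmonic : x.leadingCoeff = 1) (hpos : 0 < x.order) :
    -- the binomial series defining `x ^ i` converges to `x ^ i`, formally and in absolute value
    (∀ i : ℚ, MalcevNeumann.HasFormalSum (MalcevNeumann.powTerm x i) (MalcevNeumann.ratPow x i) ∧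
      Filter.Tendsto
        (fun N : ℕ => MalcevNeumann.absVal k
          ((∑ n ∈ Finset.range N, MalcevNeumann.powTerm x i n) - MalcevNeumann.ratPow x i))
        Filter.atTop (nhds 0)) ∧
    ∃ φ : RingAut (HahnSeries ℚ k),
      φ ∈ MalcevNeumann.autConts k ∧
      φ (HahnSeries.single 1 1) = x ∧
      -- `φ (∑ c_i t ^ i) = ∑ c_i x ^ i`
      (∀ y : HahnSeries ℚ k,
        MalcevNeumann.HasFormalSum (fun i : ℚ => HahnSeries.C (y.coeff i) * MalcevNeumann.ratPow x i) (φ y)) ∧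
      -- the same with every `x ^ i` replaced by its defining series
      (∀ y : HahnSeries ℚ k,
        MalcevNeumann.HasFormalSum
          (fun p : ℚ × ℕ => HahnSeries.C (y.coeff p.1) * MalcevNeumann.powTerm x p.1 p.2) (φ y)) := by
  refine ⟨fun i => ⟨MalcevNeumann.hasFormalSum_powTerm hmonic i,
    MalcevNeumann.tendsto_absVal_sum_powTerm_sub hmonic i⟩,
    MalcevNeumann.substEquiv hmonic hpos, MalcevNeumann.substEquiv_mem_autConts hmonic hpos, ?_,
    MalcevNeumann.hasFormalSum_subst_ratPow hmonic hpos,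
    MalcevNeumann.hasFormalSum_subst_powTerm hmonic hpos⟩
  rw [MalcevNeumann.substEquiv_apply, MalcevNeumann.subst_single hmonic, map_one, one_mul,
    MalcevNeumann.ratPow_one hmonic]
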